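/- Let $n\ge 3$, let $D^n\subset\mathbb R^n$ be the closed unit ball, $S^{n-1}=\partial D^n$, and let $G$ be a group. A \emph{generalized cell decomposition} of $D^n$ is a pair $(K,\mathcal U)$ where $K\subset D^n$ is closed with $S^{n-1}\subset K$, $\mathcal U$ is the collection of connected components of $D^n\setminus K$, every $U\in\mathcal U$ is homeomorphic to $\mathrm{int}(D^n)$ with $\partial U$ homeomorphic to $S^{n-1}$, and every sequence of distinct elements of $\mathcal U$ has a subsequence $(U_k)_k$ such that the set of limits of convergent sequences $(x_k)_k$ with $x_k\in U_k$ for all $k$ is a single point. A \emph{$G$-complex} on $D^n$ is a triple $(\mu,K,\mathcal U)$ where $(K,\mathcal U)$ is a generalized cell decomposition of $D^n$ and $\mu:G\to\mathrm{Homeo}(K)$ is an injective map with $\mu(gh)=\mu(h)\circ\mu(g)$ such that for every $g\in G$: $\mu(g)(S^{n-1})=S^{n-1}$, the restriction of $\mu(g)$ to $S^{n-1}$ is orientation preserving, and for every $U\in\mathcal U$ there is a (necessarily unique) cell $\mu(g)(U)\in\mathcal U$ with $\mu(g)(\partial U)=\partial(\mu(g)(U))$; moreover, there are homeomorphisms of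 pairs $\Phi^U:(D^n,S^{n-1})\to(\overline U,\partial U)$, $U\in\mathcal U$, each fixing every point of $S^{n-1}\cap\partial U$, with $\mu(g)\circ\Phi^U=\Phi^{\mu(g)(U)}\circ\mu(g)$ on $S^{n-1}$ for all $g\in G$ and $U\in\mathcal U$. The $G$-complex is \emph{free} if for $g\neq 1$ the map $\mu(g)$ has no fixed point in $K\cap\mathrm{int}(D^n)$. It is a \emph{convergence} $G$-complex if every sequence of distinct elements of $\mu(G)$ has a subsequence that converges, for some $a,b\in K$, to the constant map $a$ uniformly on compact subsets of $K\setminus\{b\}$. A $G$-complex $(\mu_0,K_0,\mathcal U_0)$ is a \emph{refinement} of $(\mu,K,\mathcal U)$ if $K\subset K_0$ and $\mu_0(g)=\mu(g)$ on $K$ for all $g\in G$. Let $(\mu,K,\mathcal U)$ be a free convergence $G$-complex on $D^n$ such that for every $U\in\mathcal U$ the stabilizer $\mathrm{Stab}_\mu(U)=\{g\in G\mid \mu(g)(\partial U)=\partial U\}$ is trivial. Then there exists a free convergence $G$-complex $(\mu_0,D^n,\emptyset)$ that is a refinement of $(\mu,K,\mathcal U)$. In particular, the action of $G$ on $S^{n-1}$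 given by $\mu$ extends to a convergence action of $G$ on $D^n$ that is free on $\mathrm{int}(D^n)$. -/

import Mathlib

namespace GComplexes

open Set Filter Topology CategoryTheory

/-- The closed unit ball `D^n` in Euclidean space `ℝ^n`. -/
abbrev Disk (n : ℕ) : Set (EuclideanSpace ℝ (Fin n)) := Metric.closedBall 0 1

/-- The unit sphere `S^{n-1}`, the boundary of `D^n`. -/
abbrev Sph (n : ℕ) : Set (EuclideanSpace ℝ (Fin n)) := Metric.sphere 0 1

/-- The open unit ball, the interior of `D^n`. -/
abbrev IntDisk (n : ℕ) : Set (EuclideanSpace ℝ (Fin n)) := Metric.ball 0 1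

/-- The set of limits of convergent sequences `(x_m)` with `x_m ∈ U_m` for every `m`. -/
def setLim {X : Type*} [TopologicalSpace X] (U : ℕ → Set X) : Set X :=
  {p | ∃ x : ℕ → X, (∀ m, x m ∈ U m) ∧ Tendsto x atTop (𝓝 p)}

/-- A group of homeomorphisms of `X` is a convergence group if every sequence of distinct elements
has a subsequence that converges to a constant `a`, uniformly on compact subsets of `X \ {b}`,
for some `a, b ∈ X`. -/
def IsConvergenceGroup {X : Type*} [UniformSpace X] (H : Subgroup (X ≃ₜ X)) : Prop :=
  ∀ h : ℕ → (X ≃ₜ X), Function.Injective h → (∀ m, h m ∈ H) →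
    ∃ φ : ℕ → ℕ, StrictMono φ ∧ ∃ a b : X, ∀ C : Set X, IsCompact C → b ∉ C →
      TendstoUniformlyOn (fun k x => h (φ k) x) (fun _ => a) atTop C

/-- A homeomorphism of `S^{n-1}` preserves orientation if it acts as the identity on the
singular homology group `H_{n-1}(S^{n-1}; ℤ)`. -/
def OrientationPreserving {n : ℕ} (f : Sph n ≃ₜ Sph n) : Prop :=
  ((AlgebraicTopology.singularHomologyFunctor (ModuleCat.{0} ℤ) (n - 1)).obj
    (ModuleCat.of ℤ ℤ)).map (TopCat.ofHom (f : C(Sph n, Sph n))) = 𝟙 _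

variable {n : ℕ}

/-- The collection of connected components of `D^n \ K`. -/
def components (K : Set (EuclideanSpace ℝ (Fin n))) : Set (Set (EuclideanSpace ℝ (Fin n))) :=
  {U | ∃ x ∈ Disk n \ K, U = connectedComponentIn (Disk n \ K) x}

/-- `(K, 𝒰)` is a generalized cell decomposition of `D^n`. -/
structure IsCellDecomposition (K : Set (EuclideanSpace ℝ (Fin n)))
    (𝒰 : Set (Set (EuclideanSpace ℝ (Fin n)))) : Prop where
  subset_disk : K ⊆ Disk n
  isClosed : IsClosed K
  cells_eq : 𝒰 = components K
  sphere_subset : Sph n ⊆ K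
  cell_homeo : ∀ U ∈ 𝒰, Nonempty (U ≃ₜ IntDisk n)
  frontier_homeo : ∀ U ∈ 𝒰, Nonempty (frontier U ≃ₜ Sph n)
  exists_lim_eq_singleton : ∀ U : ℕ → Set (EuclideanSpace ℝ (Fin n)), Function.Injective U →
    (∀ m, U m ∈ 𝒰) → ∃ φ : ℕ → ℕ, StrictMono φ ∧ ∃ p, setLim (fun k => U (φ k)) = {p}

variable {G : Type*} [Group G] {K K' : Set (EuclideanSpace ℝ (Fin n))}

/-- The homeomorphism `μ(g)` of `K`. Actions `G → Homeo(K)` are homomorphisms into the opposite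
of the group of homeomorphisms (with composition), so that `μ(gh) = μ(h) ∘ μ(g)`. -/
def act (μ : G →* (K ≃ₜ K)ᵐᵒᵖ) (g : G) : K ≃ₜ K := (μ g).unop

/-- A subset of `ℝ^n` contained in `K` (such as `S^{n-1}`, or the boundary of a component of
`D^n \ K`), regarded as a subset of the space `K`. -/
abbrev within (K A : Set (EuclideanSpace ℝ (Fin n))) : Set K := {x | (x : EuclideanSpace ℝ (Fin n)) ∈ A}

/-- `μ` is a `G`-action on `(K, 𝒰)`: it is faithful, preserves the sphere, permutes the boundaries
of the cells, and restricts to orientation preserving homeomorphisms of the sphere. -/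
structure IsGAction (μ : G →* (K ≃ₜ K)ᵐᵒᵖ) (𝒰 : Set (Set (EuclideanSpace ℝ (Fin n)))) : Prop where
  faithful : Function.Injective μ
  map_sphere : ∀ g, act μ g '' within K (Sph n) = within K (Sph n)
  map_frontier : ∀ g, ∀ U ∈ 𝒰, ∃ U' ∈ 𝒰,
    act μ g '' within K (frontier U) = within K (frontier U')
  orientation : ∀ g, ∃ f : Sph n ≃ₜ Sph n, OrientationPreserving f ∧
    ∀ (x : K) (s : Sph n), (x : EuclideanSpace ℝ (Fin n)) = s →
      (act μ g x : EuclideanSpace ℝ (Fin n)) = f s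

/-- The stabilizer of a cell `U`. -/
def stab (μ : G →* (K ≃ₜ K)ᵐᵒᵖ) (U : Set (EuclideanSpace ℝ (Fin n))) : Set G :=
  {g | act μ g '' within K (frontier U) = within K (frontier U)}

/-- The homeomorphisms `Φ^U : (D^n, S^{n-1}) → (closure of U, ∂U)`, for the cells `U`, fix the
points of `S^{n-1} ∩ ∂U` and are equivariant on the sphere. In `equivariant`, the cell `U'` is
`μ(g)(U)`, `x` is a point of the sphere (called `s` as a point of `D^n`), `s'` is `μ(g)(x)`
and `y` is `Φ^U(x)`; the conclusion is `μ(g)(Φ^U(x)) = Φ^{U'}(μ(g)(x))`. -/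
structure IsMarking (μ : G →* (K ≃ₜ K)ᵐᵒᵖ) (𝒰 : Set (Set (EuclideanSpace ℝ (Fin n))))
    (Φ : ∀ U : 𝒰, Disk n ≃ₜ closure (U : Set (EuclideanSpace ℝ (Fin n)))) : Prop where
  mem_frontier_iff : ∀ (U : 𝒰) (s : Disk n),
    (Φ U s : EuclideanSpace ℝ (Fin n)) ∈ frontier (U : Set (EuclideanSpace ℝ (Fin n))) ↔
      (s : EuclideanSpace ℝ (Fin n)) ∈ Sph n
  fixes : ∀ (U : 𝒰) (s : Disk n), (s : EuclideanSpace ℝ (Fin n)) ∈ Sph n →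
    (s : EuclideanSpace ℝ (Fin n)) ∈ frontier (U : Set (EuclideanSpace ℝ (Fin n))) →
      (Φ U s : EuclideanSpace ℝ (Fin n)) = s
  equivariant : ∀ (g : G) (U U' : 𝒰),
    act μ g '' within K (frontier (U : Set (EuclideanSpace ℝ (Fin n)))) =
        within K (frontier (U' : Set (EuclideanSpace ℝ (Fin n)))) →
      ∀ (x y : K) (s s' : Disk n), (x : EuclideanSpace ℝ (Fin n)) ∈ Sph n →
        (s : EuclideanSpace ℝ (Fin n)) = x →
        (s' : EuclideanSpace ℝ (Fin n)) = act μ g x →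
        (y : EuclideanSpace ℝ (Fin n)) = Φ U s →
        (act μ g y : EuclideanSpace ℝ (Fin n)) = Φ U' s'

/-- The triple `(μ, K, 𝒰)` is a `G`-complex on `D^n`. -/
structure IsGComplex (μ : G →* (K ≃ₜ K)ᵐᵒᵖ) (𝒰 : Set (Set (EuclideanSpace ℝ (Fin n)))) :
    Prop where
  cellDecomposition : IsCellDecomposition K 𝒰
  action : IsGAction μ 𝒰
  exists_marking : ∃ Φ : ∀ U : 𝒰, Disk n ≃ₜ closure (U : Set (EuclideanSpace ℝ (Fin n))),
    IsMarking μ 𝒰 Φ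

/-- Nontrivial elements of `G` have no fixed points in `K ∩ int(D^n)`. -/
def IsFree (μ : G →* (K ≃ₜ K)ᵐᵒᵖ) : Prop :=
  ∀ g : G, g ≠ 1 → ∀ x : K, (x : EuclideanSpace ℝ (Fin n)) ∈ IntDisk n → act μ g x ≠ x

/-- The image `μ(G)` is a convergence group on `K`. -/
def IsConvergence (μ : G →* (K ≃ₜ K)ᵐᵒᵖ) : Prop :=
  IsConvergenceGroup μ.range.unop

/-- The complex with action `μ` on `K` refines the complex with action `μ'` on `K'`:
`K' ⊆ K` and `μ(g) = μ'(g)` on `K'`. -/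
def IsRefinement (μ : G →* (K ≃ₜ K)ᵐᵒᵖ) (μ' : G →* (K' ≃ₜ K')ᵐᵒᵖ) : Prop :=
  K' ⊆ K ∧ ∀ (g : G) (x : K) (x' : K'), (x : EuclideanSpace ℝ (Fin n)) = x' →
    (act μ g x : EuclideanSpace ℝ (Fin n)) = act μ' g x'

end GComplexes

/-! ### A zero theorem of Brouwer type, by a volume argument. -/

section Brouwer

open Set Filter Topology MeasureTheory Metric

variable {E : Type*} [NormedAddCommGroup E] [InnerProductSpace ℝ E] [FiniteDimensional ℝ E]

/-! The action is extended over each cell by coning. Read through the markings, `μ(g)` maps `∂U` to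
`∂(μ(g)(U))` as it maps the sphere to itself, so `Φ^{μ(g)(U)} ∘ cone(μ(g)) ∘ (Φ^U)⁻¹` maps `closure
U` to the closure of `μ(g)(U)` and agrees with `μ(g)` on `∂U`. Coning respects composition, so these
maps form an action without any choice of orbit representatives
(`IsGComplex.exists_isCellwiseAction`). Trivial stabilizers mean that `g ≠ 1` moves every cell off
itself, so no fixed points arise in the cells.

Continuity and the convergence property pass from `K` to the disk because the cells form a null
family: a point in a cell that escapes to infinity in the index set has the same limits as any
boundary point of that cell (`continuous_cellwiseMap`, `seqCollapse`).

The cell `μ(g)(U)` must be determined by its boundary for the permutation of the cells to be an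
action. Two distinct cells with a common boundary would give a map that replaces one cell by the
closure of the other, is the identity elsewhere, and misses a point. This contradicts Brouwer
(`IsMarking.cell_eq_of_frontier_eq`, `exists_eq_zero_of_eq_self_of_lt_norm`). -/

theorem ContinuousLinearMap.surjective_of_det_ne_zero {A : E →L[ℝ] E} (h : A.det ≠ 0) :
    Function.Surjective A := by
  have h1 : IsUnit (A : E →ₗ[ℝ] E) :=
    (LinearMap.isUnit_iff_isUnit_det _).2 (isUnit_iff_ne_zero.2 h)
  exact ((Module.End.isUnit_iff _).1 h1).surjective

theorem ContinuousLinearMap.det_one_add_smul_ne_zero {A : E →L[ℝ] E} {t : ℝ}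
    (h : |t| * ‖A‖ < 1) : (1 + t • A).det ≠ 0 := by
  have hinj : Function.Injective ((1 + t • A : E →L[ℝ] E) : E →ₗ[ℝ] E) := by
    rw [← LinearMap.ker_eq_bot, LinearMap.ker_eq_bot']
    intro v hv
    have hv' : v = -(t • A v) := by
      have : v + t • A v = 0 := by simpa using hv
      exact eq_neg_of_add_eq_zero_left this
    by_contra hne
    have h1 : ‖v‖ ≤ |t| * ‖A‖ * ‖v‖ := by
      calc ‖v‖ = ‖t • A v‖ := by conv_lhs => rw [hv', norm_neg]
        _ = |t| * ‖A v‖ := by rw [norm_smul, Real.norm_eq_abs]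
        _ ≤ |t| * (‖A‖ * ‖v‖) := by gcongr; exact A.le_opNorm v
        _ = _ := by ring
    nlinarith [norm_pos_iff.2 hne]
  intro h0
  have := LinearMap.bot_lt_ker_of_det_eq_zero (f := ((1 + t • A : E →L[ℝ] E) : E →ₗ[ℝ] E)) h0
  rw [LinearMap.ker_eq_bot.2 hinj] at this
  exact lt_irrefl _ this

/-- The determinant of `1 + tA` is a polynomial in `t`. -/
theorem ContinuousLinearMap.exists_polynomial_det_one_add_smul (A : E →L[ℝ] E) :
    ∃ p : Polynomial ℝ, p.natDegree ≤ Module.finrank ℝ E ∧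
      ∀ t : ℝ, p.eval t = (1 + t • A).det := by
  classical
  let b := Module.finBasis ℝ E
  let M := LinearMap.toMatrix b b (A : E →ₗ[ℝ] E)
  refine ⟨((Polynomial.X : Polynomial ℝ) • M.map Polynomial.C +
    (1 : Matrix _ _ ℝ).map Polynomial.C).det, ?_, fun t => ?_⟩
  · simpa using Polynomial.natDegree_det_X_add_C_le M 1
  · have h1 : LinearMap.toMatrix b b ((1 + t • A : E →L[ℝ] E) : E →ₗ[ℝ] E) = 1 + t • M := by
      have : ((1 + t • A : E →L[ℝ] E) : E →ₗ[ℝ] E) = LinearMap.id + t • (A : E →ₗ[ℝ] E) := rfl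
      rw [this, map_add, map_smul, LinearMap.toMatrix_id]
    rw [ContinuousLinearMap.det, ← LinearMap.det_toMatrix b, h1, ← Polynomial.coe_evalRingHom,
      RingHom.map_det]
    congr 1
    ext i j
    simp [add_comm, Matrix.one_apply, apply_ite]
    ring

/-- The determinant is continuous in `t`, equals 1 at 0, and cannot vanish while `t * ‖A‖ < 1`. -/
theorem ContinuousLinearMap.det_one_add_smul_pos {A : E →L[ℝ] E} {t : ℝ} (ht : 0 ≤ t)
    (h : t * ‖A‖ < 1) : 0 < (1 + t • A).det := by
  obtain ⟨p, -, hp⟩ := A.exists_polynomial_det_one_add_smul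
  by_contra hneg
  rw [← hp t, not_lt] at hneg
  have h0 : p.eval 0 = 1 := by rw [hp]; simp [ContinuousLinearMap.det]
  obtain ⟨s, hs, hs0⟩ := intermediate_value_Icc' ht p.continuous.continuousOn
    (show (0 : ℝ) ∈ Icc (p.eval t) (p.eval 0) from ⟨hneg, by simp [h0]⟩)
  replace hs0 : p.eval s = 0 := hs0
  rw [hp] at hs0
  refine ContinuousLinearMap.det_one_add_smul_ne_zero ?_ hs0
  rw [abs_of_nonneg hs.1]
  exact lt_of_le_of_lt (by gcongr; exact hs.2) h

/-- A Lipschitz perturbation of the identity that fixes the sphere maps the ball onto itself. -/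
theorem image_ball_id_add_smul {u : E → E} {ρ t : ℝ} {L : NNReal} (hu : ContDiff ℝ 1 u)
    (hL : LipschitzOnWith L u (closedBall 0 ρ)) (ht : 0 ≤ t) (htL : t * L < 1)
    (hu0 : ∀ x, ‖x‖ = ρ → u x = 0)
    (hmaps : ∀ x, ‖x‖ ≤ ρ → ‖x + t • u x‖ ≤ ρ) :
    InjOn (fun x => x + t • u x) (ball 0 ρ) ∧
      (fun x => x + t • u x) '' ball 0 ρ = ball 0 ρ ∧
      ∀ x ∈ ball (0 : E) ρ, 0 < (1 + t • fderiv ℝ u x).det := by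
  have hinj : InjOn (fun x => x + t • u x) (closedBall 0 ρ) := by
    intro x hx y hy hxy
    have h1 : x - y = t • (u y - u x) := by
      simp only at hxy
      rw [smul_sub, sub_eq_sub_iff_add_eq_add, hxy, add_comm]
    by_contra hne
    have h2 : ‖x - y‖ ≤ t * (L * ‖x - y‖) := by
      calc ‖x - y‖ = t * ‖u x - u y‖ := by
            conv_lhs => rw [h1, norm_smul, Real.norm_of_nonneg ht, norm_sub_rev]
        _ ≤ _ := by gcongr; exact hL.norm_sub_le hx hy
    nlinarith [norm_pos_iff.2 (sub_ne_zero.2 hne)]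
  have hnorm : ∀ x ∈ ball (0 : E) ρ, t * ‖fderiv ℝ u x‖ < 1 := by
    intro x hx
    refine lt_of_le_of_lt ?_ htL
    gcongr
    exact (hu.differentiable (by simp) x).hasFDerivAt.le_of_lipschitzOn
      (closedBall_mem_nhds_of_mem hx) hL
  have hcont : Continuous (fun x => x + t • u x) := by
    have := hu.continuous
    fun_prop
  refine ⟨hinj.mono ball_subset_closedBall, ?_, fun x hx =>
    ContinuousLinearMap.det_one_add_smul_pos ht (hnorm x hx)⟩
  rcases le_or_gt ρ 0 with hρ | hρ
  · simp [ball_eq_empty.2 hρ]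
  have hsub : (fun x => x + t • u x) '' ball 0 ρ ⊆ ball 0 ρ := by
    rintro _ ⟨x, hx, rfl⟩
    have hx' : ‖x‖ < ρ := by simpa using hx
    have := hmaps x hx'.le
    rcases this.lt_or_eq with h | h
    · simpa using h
    · exfalso
      -- The image point lies on the sphere, where `u = 0`, so it is fixed; injectivity makes it
      -- equal to `x`, which is interior.
      have : x + t • u x = x :=
        (hinj (x₁ := x + t • u x) (by simp [h]) (by simpa using hx'.le) (by simp [hu0 _ h]))
      rw [this] at h
      exact hx'.ne h
  have hopen : IsOpen ((fun x => x + t • u x) '' ball 0 ρ) := by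
    rw [isOpen_iff_mem_nhds]
    rintro _ ⟨x, hx, rfl⟩
    have hs : HasStrictFDerivAt (fun x => x + t • u x) (1 + t • fderiv ℝ u x : E →L[ℝ] E) x :=
      (hasStrictFDerivAt_id x).add ((hu.contDiffAt.hasStrictFDerivAt (by simp)).const_smul t)
    have hdet := ContinuousLinearMap.det_one_add_smul_pos ht (hnorm x hx)
    have hsurj : (1 + t • fderiv ℝ u x : E →L[ℝ] E).range = ⊤ := by
      exact LinearMap.range_eq_top.2 (ContinuousLinearMap.surjective_of_det_ne_zero hdet.ne')
    rw [← hs.map_nhds_eq_of_surj hsurj]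
    exact image_mem_map (isOpen_ball.mem_nhds hx)
  refine (hsub.antisymm ?_)
  have hconn : IsPreconnected (ball (0 : E) ρ) := (convex_ball 0 ρ).isPreconnected
  -- The image is open and relatively closed in the connected ball.
  refine hconn.subset_of_closure_inter_subset hopen ?_ ?_
  · refine ⟨_, ?_, mem_image_of_mem _ (mem_ball_self hρ)⟩
    exact hsub (mem_image_of_mem _ (mem_ball_self hρ))
  · rintro y ⟨hy, hyb⟩
    have hcl : IsClosed ((fun x => x + t • u x) '' closedBall 0 ρ) :=
      ((isCompact_closedBall 0 ρ).image hcont).isClosed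
    obtain ⟨x, hx, rfl⟩ := closure_minimal (image_mono ball_subset_closedBall) hcl hy
    refine ⟨x, ?_, rfl⟩
    have hx' : ‖x‖ ≤ ρ := by simpa using hx
    rcases hx'.lt_or_eq with h | h
    · simpa using h
    · exfalso
      simp [hu0 x h, h] at hyb

/-- Milnor–Rogers argument: for `u = f - id` let `I t` be the integral over the ball of the Jacobian
of `id + t u`. For small `t` this map is a bijection of the ball, so `I t` is the volume. The
Jacobian is polynomial in `t`, so `I 1` is the volume too. But `id + u = f` takes values in a
sphere, so its Jacobian is 0. -/
theorem not_exists_contDiff_retraction {f : E → E} {ρ : ℝ} (hρ : 0 < ρ)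
    (hf : ContDiff ℝ 1 f) (hfn : ∀ x, ‖f x‖ = ρ) (hfid : ∀ x, ‖x‖ = ρ → f x = x) : False := by
  let _ : MeasurableSpace E := borel E
  have : BorelSpace E := ⟨rfl⟩
  set u : E → E := fun x => f x - x with hu_def
  have hu : ContDiff ℝ 1 u := hf.sub contDiff_id
  obtain ⟨L, hL⟩ := hu.contDiffOn.exists_lipschitzOnWith (n := 1) (by simp)
    (convex_closedBall (0 : E) ρ) (isCompact_closedBall 0 ρ)
  set d := Module.finrank ℝ E
  set c : ℝ := volume.real (ball (0 : E) ρ) with hc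
  have hcpos : 0 < c := ENNReal.toReal_pos (measure_ball_pos _ _ hρ).ne' measure_ball_lt_top.ne
  set I : ℝ → ℝ := fun t => ∫ x in ball (0 : E) ρ, (1 + t • fderiv ℝ u x).det with hI
  have hdc : ∀ t : ℝ, Continuous fun x => (1 + t • fderiv ℝ u x).det := by
    intro t
    have h1 : Continuous (fderiv ℝ u) := hu.continuous_fderiv (by simp)
    exact ContinuousLinearMap.continuous_det.comp (by fun_prop)
  have hdet_integrable : ∀ t : ℝ, IntegrableOn (fun x => (1 + t • fderiv ℝ u x).det) (ball 0 ρ) volume :=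
    fun t => ((hdc t).continuousOn.integrableOn_compact (isCompact_closedBall 0 ρ)).mono_set
      ball_subset_closedBall
  have hsmall : ∀ t : ℝ, 0 ≤ t → t ≤ 1 → t * L < 1 → I t = c := by
    intro t ht ht1 htL
    obtain ⟨h1, h2, h3⟩ := image_ball_id_add_smul hu hL ht htL
      (fun x hx => by simp [hu_def, hfid x hx]) (fun x hx => by
        have : x + t • u x = (1 - t) • x + t • f x := by simp only [hu_def]; module
        rw [this]
        calc _ ≤ ‖(1 - t) • x‖ + ‖t • f x‖ := norm_add_le _ _
          _ = (1 - t) * ‖x‖ + t * ρ := by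
            rw [norm_smul, norm_smul, hfn, Real.norm_of_nonneg ht,
              Real.norm_of_nonneg (sub_nonneg.2 ht1)]
          _ ≤ (1 - t) * ρ + t * ρ := by gcongr
          _ = ρ := by ring)
    have h4 := integral_image_eq_integral_abs_det_fderiv_smul volume
      (f' := fun x => 1 + t • fderiv ℝ u x)
      (measurableSet_ball (x := (0 : E)) (ε := ρ))
      (fun x _ => ((hasFDerivAt_id x).add
        ((hu.differentiable (by simp) x).hasFDerivAt.const_smul t)).hasFDerivWithinAt) h1
      (fun _ => (1 : ℝ))
    rw [show (id + t • u) '' ball 0 ρ = ball (0 : E) ρ from h2] at h4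
    simp only [smul_eq_mul, mul_one, integral_const, measureReal_restrict_apply_univ] at h4
    rw [hI, hc, h4]
    refine setIntegral_congr_fun measurableSet_ball fun x hx => ?_
    exact (abs_of_pos (h3 x hx)).symm
  have hone : I 1 = 0 := by
    rw [hI]
    refine (setIntegral_congr_fun (g := fun _ => (0 : ℝ)) measurableSet_ball fun x _ => ?_).trans
      (by simp)
    have hfd := (hf.differentiable (by simp) x).hasFDerivAt
    have hud : fderiv ℝ u x = fderiv ℝ f x - 1 := (hfd.sub (hasFDerivAt_id x)).fderiv
    -- Differentiating the constant `‖f‖²` shows that `f x` is not in the range of the derivative.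
    have horth : ∀ v, inner ℝ (f x) (fderiv ℝ f x v) = 0 := by
      intro v
      have h1 : HasFDerivAt (fun y => ‖f y‖ ^ 2) _ x := hfd.norm_sq
      have h2 : HasFDerivAt (fun y => ‖f y‖ ^ 2) (0 : E →L[ℝ] ℝ) x := by
        simp only [hfn]; exact hasFDerivAt_const _ _
      have := congrArg (fun T : E →L[ℝ] ℝ => T v) (h1.unique h2)
      simpa using this
    simp only [hud, one_smul, add_sub_cancel]
    by_contra hdet
    obtain ⟨v, hv⟩ := ContinuousLinearMap.surjective_of_det_ne_zero hdet (f x)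
    have := horth v
    rw [hv, real_inner_self_eq_norm_sq, hfn] at this
    exact (pow_pos hρ 2).ne' this
  -- interpolate the polynomial in `t` from its values at small `t`
  let v : ℕ → ℝ := fun i => 1 / ((L + 1) * (i + 1))
  have hv0 : ∀ i, 0 ≤ v i := fun i => by positivity
  have hvL : ∀ i, v i * L < 1 := fun i => by
    simp only [v]
    rw [one_div, inv_mul_lt_one₀ (by positivity)]
    have : (0 : ℝ) ≤ i := by positivity
    nlinarith [L.coe_nonneg]
  have hv1 : ∀ i, v i ≤ 1 := fun i => by
    simp only [v]
    rw [one_div]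
    refine inv_le_one_of_one_le₀ ?_
    have : (0 : ℝ) ≤ i := by positivity
    nlinarith [L.coe_nonneg]
  have hvinj : Function.Injective v := by
    intro i j hij
    simp only [v, one_div, inv_inj] at hij
    have := mul_left_cancel₀ (by positivity) hij
    exact_mod_cast add_right_cancel this
  set s := Finset.range (d + 1)
  let w : ℕ → ℝ := fun i => (Lagrange.basis s v i).eval 1
  have hw : ∑ i ∈ s, w i = 1 := by
    have := Lagrange.sum_basis (s := s) (v := v) hvinj.injOn (by simp [s])
    have := congrArg (Polynomial.eval 1) this
    simpa [Polynomial.eval_finsetSum] using this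
  have hinterp : ∀ x, (1 + (1 : ℝ) • fderiv ℝ u x).det =
      ∑ i ∈ s, w i * (1 + v i • fderiv ℝ u x).det := by
    intro x
    obtain ⟨p, hpd, hp⟩ := (fderiv ℝ u x).exists_polynomial_det_one_add_smul
    have := Lagrange.eq_interpolate (f := p) (s := s) (v := v) hvinj.injOn (by
      refine lt_of_le_of_lt Polynomial.degree_le_natDegree ?_
      simp only [s, Finset.card_range]
      exact_mod_cast Nat.lt_succ_of_le hpd)
    rw [← hp 1, this, Lagrange.interpolate_apply, Polynomial.eval_finsetSum]
    refine Finset.sum_congr rfl fun i _ => ?_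
    rw [← hp]
    simp [w, mul_comm]
  have : I 1 = c := by
    calc I 1 = ∫ x in ball (0 : E) ρ, ∑ i ∈ s, w i * (1 + v i • fderiv ℝ u x).det := by
          simp only [hI, hinterp]
      _ = ∑ i ∈ s, w i * I (v i) := by
          rw [integral_finsetSum _ fun i _ => (hdet_integrable (v i)).const_mul (w i)]
          simp only [integral_const_mul, hI]
      _ = ∑ i ∈ s, w i * c := by
          refine Finset.sum_congr rfl fun i _ => ?_
          rw [hsmall _ (hv0 i) (hv1 i) (hvL i)]
      _ = c := by rw [← Finset.sum_mul, hw, one_mul]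
  linarith

/-- A continuous self-map of a Euclidean space that is the identity outside a ball has a zero. -/
theorem exists_eq_zero_of_eq_self_of_lt_norm {F : E → E} {R : ℝ} (hF : Continuous F)
    (hR : ∀ x, R < ‖x‖ → F x = x) : ∃ x, F x = 0 := by
  by_contra! hne
  -- An error smaller than `‖F x‖` keeps the smooth approximation `g` away from 0. Radial projection
  -- of `g` to the sphere of radius `|R| + 1`, where `g` is the identity, is then a retraction.
  obtain ⟨g, hg, hgF, hgS, -⟩ := hF.exists_contDiff_approx_and_eqOn 1 (ε := fun x => ‖F x‖)
    hF.norm (fun x => norm_pos_iff.2 (hne x)) (S := {x | |R| + 1 ≤ ‖x‖}) (U := {x | |R| < ‖x‖})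
    (isClosed_le continuous_const continuous_norm)
    ((isOpen_lt continuous_const continuous_norm).mem_nhdsSet.2 fun x hx => by
      simp only [mem_ofPred_eq] at hx ⊢; linarith)
    (contDiffOn_id.congr fun x hx => hR x ((le_abs_self R).trans_lt hx))
  have hg0 : ∀ x, g x ≠ 0 := fun x h => by
    have := hgF x
    rw [h, dist_zero_left] at this
    exact lt_irrefl _ this
  have hpos : 0 < |R| + 1 := by positivity
  refine not_exists_contDiff_retraction (f := fun x => ((|R| + 1) * ‖g x‖⁻¹) • g x) hpos ?_ ?_ ?_
  · exact (contDiff_const.mul ((hg.norm ℝ hg0).inv fun x => norm_ne_zero_iff.2 (hg0 x))).smul hg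
  · intro x
    rw [norm_smul, norm_mul, norm_inv, norm_norm, Real.norm_of_nonneg hpos.le, mul_assoc,
      inv_mul_cancel₀ (norm_ne_zero_iff.2 (hg0 x)), mul_one]
  · intro x hx
    have h1 : g x = x := (hgS (by simp [hx])).trans (hR x (by
      rw [hx]; linarith [le_abs_self R]))
    simp only [h1, hx]
    rw [mul_inv_cancel₀ hpos.ne', one_smul]

end Brouwer

namespace GComplexes

open Set Filter Topology

/-- A sequence has a constant subsequence or a subsequence that leaves every finite set. -/
theorem exists_strictMono_const_or_tendsto_cofinite {ι : Type*} (u : ℕ → ι) :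
    ∃ φ : ℕ → ℕ, StrictMono φ ∧
      ((∃ i, ∀ k, u (φ k) = i) ∨ Tendsto (fun k => u (φ k)) atTop cofinite) := by
  by_cases h : Tendsto u atTop cofinite
  · exact ⟨id, strictMono_id, Or.inr h⟩
  · have : ∃ i, ∃ᶠ k in atTop, u k = i := by
      by_contra! hne
      refine h fun s hs => ?_
      have h1 : ∀ᶠ k in atTop, ∀ i ∈ sᶜ, u k ≠ i :=
        (eventually_all_finite (mem_cofinite.1 hs)).2 fun i _ => hne i
      rw [mem_map]
      filter_upwards [h1] with k hk
      by_contra hks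
      exact hk _ hks rfl
    obtain ⟨i, hi⟩ := this
    obtain ⟨φ, hφ, hφi⟩ := extraction_of_frequently_atTop hi
    exact ⟨φ, hφ, Or.inl ⟨i, hφi⟩⟩

/-! ### Gluing an action on a closed set with maps of a null family of cells. -/

section Cellwise

variable {X : Type*} [MetricSpace X] {G : Type*} [Group G] {ι : Type*}

/-- The maps `f k` converge to `a` along convergent sequences in `K` whose limit is not `b`. -/
def SeqCollapse (f : ℕ → X → X) (K : Set X) (a b : X) : Prop :=
  ∀ φ : ℕ → ℕ, Tendsto φ atTop atTop → ∀ x : ℕ → X, (∀ k, x k ∈ K) → ∀ p, p ≠ b →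
    Tendsto x atTop (𝓝 p) → Tendsto (fun k => f (φ k) (x k)) atTop (𝓝 a)

/-- A decomposition of `D` into a closed set `K` and a null family of open cells, with an action
`m` of `G` on `K` and a compatible family of maps `H g i` of the closed cells. -/
structure IsCellwiseAction (D K : Set X) (C : ι → Set X) (m : G → X → X) (σ : G → ι → ι)
    (H : G → ι → X → X) : Prop where
  isClosed : IsClosed K
  subset : K ⊆ D
  cell_subset : ∀ i, C i ⊆ D
  notMem : ∀ i, ∀ x ∈ C i, x ∉ K
  index_eq : ∀ i j x, x ∈ C i → x ∈ C j → i = j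
  cover : ∀ x ∈ D, x ∉ K → ∃ i, x ∈ C i
  frontier_subset : ∀ i, frontier (C i) ⊆ K
  frontier_nontrivial : ∀ i, (frontier (C i)).Nontrivial
  null : ∀ u : ℕ → ι, Tendsto u atTop cofinite → ∀ x y : ℕ → X, (∀ k, x k ∈ closure (C (u k))) →
    (∀ k, y k ∈ closure (C (u k))) → Tendsto (fun k => dist (x k) (y k)) atTop (𝓝 0)
  continuousOn : ∀ g, ContinuousOn (m g) K
  mapsTo : ∀ g, MapsTo (m g) K K
  mul : ∀ g h, ∀ x ∈ K, m (g * h) x = m h (m g x)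
  one : ∀ x ∈ K, m 1 x = x
  index_mul : ∀ g h i, σ (g * h) i = σ h (σ g i)
  index_one : ∀ i, σ 1 i = i
  free : ∀ g i, σ g i = i → g = 1
  cell_continuousOn : ∀ g i, ContinuousOn (H g i) (closure (C i))
  cell_mapsTo : ∀ g i, MapsTo (H g i) (C i) (C (σ g i))
  cell_eqOn : ∀ g i, EqOn (H g i) (m g) (frontier (C i))
  cell_mul : ∀ g h i, ∀ x ∈ C i, H (g * h) i x = H h (σ g i) (H g i x)
  cell_one : ∀ i, ∀ x ∈ C i, H 1 i x = x

open Classical in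
/-- The map that is `H g i` on the cell `C i` and `m g` outside the cells. -/
noncomputable def cellwiseMap (C : ι → Set X) (m : G → X → X) (H : G → ι → X → X) (g : G) (x : X) : X :=
  if h : ∃ i, x ∈ C i then H g h.choose x else m g x

namespace IsCellwiseAction

variable {D K : Set X} {C : ι → Set X} {m : G → X → X} {σ : G → ι → ι} {H : G → ι → X → X}

theorem cellwiseMap_of_mem (hA : IsCellwiseAction D K C m σ H) (g : G) {x : X} (hx : x ∈ K) :
    cellwiseMap C m H g x = m g x :=
  dif_neg fun ⟨i, hi⟩ => hA.notMem i x hi hx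

theorem cellwiseMap_of_mem_cell (hA : IsCellwiseAction D K C m σ H) (g : G) {i : ι} {x : X}
    (hx : x ∈ C i) : cellwiseMap C m H g x = H g i x := by
  have h : ∃ i, x ∈ C i := ⟨i, hx⟩
  rw [cellwiseMap, dif_pos h, hA.index_eq _ _ _ h.choose_spec hx]

theorem mem_or_mem_frontier {A : Set X} {x : X} (hx : x ∈ closure A) : x ∈ A ∨ x ∈ frontier A := by
  by_cases h : x ∈ A
  · exact Or.inl h
  · exact Or.inr ⟨hx, fun h' => h (interior_subset h')⟩

theorem cellwiseMap_of_mem_closure (hA : IsCellwiseAction D K C m σ H) (g : G) {i : ι} {x : X}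
    (hx : x ∈ closure (C i)) : cellwiseMap C m H g x = H g i x := by
  rcases mem_or_mem_frontier hx with h | h
  · exact hA.cellwiseMap_of_mem_cell g h
  · rw [hA.cellwiseMap_of_mem g (hA.frontier_subset i h), hA.cell_eqOn g i h]

theorem cellwiseMap_mem_cell (hA : IsCellwiseAction D K C m σ H) (g : G) {i : ι} {x : X}
    (hx : x ∈ C i) : cellwiseMap C m H g x ∈ C (σ g i) := by
  rw [hA.cellwiseMap_of_mem_cell g hx]
  exact hA.cell_mapsTo g i hx

theorem cellwiseMap_mem_closure (hA : IsCellwiseAction D K C m σ H) (g : G) {i : ι} {x : X}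
    (hx : x ∈ closure (C i)) : cellwiseMap C m H g x ∈ closure (C (σ g i)) := by
  rw [hA.cellwiseMap_of_mem_closure g hx]
  exact (hA.cell_mapsTo g i).closure_of_continuousOn (hA.cell_continuousOn g i) hx

theorem action_mem_closure (hA : IsCellwiseAction D K C m σ H) (g : G) {i : ι} {x : X}
    (hx : x ∈ frontier (C i)) : m g x ∈ closure (C (σ g i)) := by
  rw [← hA.cellwiseMap_of_mem g (hA.frontier_subset i hx)]
  exact hA.cellwiseMap_mem_closure g (frontier_subset_closure hx)

theorem cellwiseMap_mapsTo (hA : IsCellwiseAction D K C m σ H) (g : G) :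
    MapsTo (cellwiseMap C m H g) D D := by
  intro x hx
  by_cases hK : x ∈ K
  · rw [hA.cellwiseMap_of_mem g hK]
    exact hA.subset (hA.mapsTo g hK)
  · obtain ⟨i, hi⟩ := hA.cover x hx hK
    exact hA.cell_subset _ (hA.cellwiseMap_mem_cell g hi)

theorem cellwiseMap_mul (hA : IsCellwiseAction D K C m σ H) (g h : G) {x : X} (hx : x ∈ D) :
    cellwiseMap C m H (g * h) x = cellwiseMap C m H h (cellwiseMap C m H g x) := by
  by_cases hK : x ∈ K
  · rw [hA.cellwiseMap_of_mem _ hK, hA.cellwiseMap_of_mem _ hK,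
      hA.cellwiseMap_of_mem _ (hA.mapsTo g hK), hA.mul g h x hK]
  · obtain ⟨i, hi⟩ := hA.cover x hx hK
    rw [hA.cellwiseMap_of_mem_cell _ (hA.cellwiseMap_mem_cell g hi),
      hA.cellwiseMap_of_mem_cell _ hi, hA.cellwiseMap_of_mem_cell _ hi, hA.cell_mul g h i x hi]

theorem cellwiseMap_one (hA : IsCellwiseAction D K C m σ H) {x : X} (hx : x ∈ D) :
    cellwiseMap C m H 1 x = x := by
  by_cases hK : x ∈ K
  · rw [hA.cellwiseMap_of_mem _ hK, hA.one x hK]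
  · obtain ⟨i, hi⟩ := hA.cover x hx hK
    rw [hA.cellwiseMap_of_mem_cell _ hi, hA.cell_one i x hi]

theorem eq_one_of_cellwiseMap_eq (hA : IsCellwiseAction D K C m σ H) {g : G} {x : X} (hx : x ∈ D)
    (hK : x ∉ K) (hfix : cellwiseMap C m H g x = x) : g = 1 := by
  obtain ⟨i, hi⟩ := hA.cover x hx hK
  have := hA.cellwiseMap_mem_cell g hi
  rw [hfix] at this
  exact hA.free g i (hA.index_eq _ _ _ this hi)

theorem index_inv (hA : IsCellwiseAction D K C m σ H) (g : G) (i : ι) : σ g⁻¹ (σ g i) = i := by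
  rw [← hA.index_mul, mul_inv_cancel, hA.index_one]

theorem index_injective (hA : IsCellwiseAction D K C m σ H) (g : G) :
    Function.Injective (σ g) :=
  Function.LeftInverse.injective (hA.index_inv g)

theorem index_orbit_injective (hA : IsCellwiseAction D K C m σ H) (i : ι) :
    Function.Injective fun g => σ g i := by
  intro g h hgh
  have : σ (g * h⁻¹) i = i := by
    rw [hA.index_mul]
    simp only at hgh
    rw [hgh, hA.index_inv]
  exact mul_inv_eq_one.1 (hA.free _ i this)

/-- The three regimes of every limit argument below: inside `K`, inside one cell, or in cells
leaving every finite set. -/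
theorem exists_subseq (hA : IsCellwiseAction D K C m σ H) {x : ℕ → X} (hx : ∀ k, x k ∈ D) :
    ∃ φ : ℕ → ℕ, StrictMono φ ∧ ((∀ k, x (φ k) ∈ K) ∨ (∃ i, ∀ k, x (φ k) ∈ C i) ∨
      ∃ u : ℕ → ι, Tendsto u atTop cofinite ∧ ∀ k, x (φ k) ∈ C (u k)) := by
  by_cases h : ∃ᶠ k in atTop, x k ∈ K
  · obtain ⟨φ, hφ, hφK⟩ := extraction_of_frequently_atTop h
    exact ⟨φ, hφ, Or.inl hφK⟩
  · rw [not_frequently] at h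
    obtain ⟨φ, hφ, hφK⟩ := extraction_of_eventually_atTop h
    choose u hu using fun k => hA.cover _ (hx (φ k)) (hφK k)
    obtain ⟨ψ, hψ, ⟨i, hi⟩ | hc⟩ := exists_strictMono_const_or_tendsto_cofinite u
    · exact ⟨φ ∘ ψ, hφ.comp hψ, Or.inr (Or.inl ⟨i, fun k => hi k ▸ hu (ψ k)⟩)⟩
    · exact ⟨φ ∘ ψ, hφ.comp hψ, Or.inr (Or.inr ⟨_, hc, fun k => hu (ψ k)⟩)⟩

theorem tendsto_of_tendsto_dist {x y : ℕ → X} {p : X} (hx : Tendsto x atTop (𝓝 p))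
    (h : Tendsto (fun k => dist (y k) (x k)) atTop (𝓝 0)) : Tendsto y atTop (𝓝 p) :=
  (tendsto_iff_of_dist h).2 hx

/-- Only points in escaping cells need an argument. Boundary points of these cells shadow them, and
since the index map is injective the image cells escape too, so the images are also shadowed. -/
theorem continuous_cellwiseMap (hA : IsCellwiseAction D K C m σ H) (g : G) :
    Continuous fun x : D => cellwiseMap C m H g x := by
  rw [continuous_iff_seqContinuous]
  intro x p hxp
  refine tendsto_of_subseq_tendsto fun ns hns => ?_
  replace hxp : Tendsto (fun k => (x (ns k) : X)) atTop (𝓝 (p : X)) :=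
    (continuous_subtype_val.tendsto p).comp (hxp.comp hns)
  obtain ⟨φ, hφ, hK | ⟨i, hi⟩ | ⟨u, hu, hux⟩⟩ := hA.exists_subseq fun k => (x (ns k)).2
  all_goals
    refine ⟨φ, ?_⟩
    replace hxp := hxp.comp hφ.tendsto_atTop
    simp only [Function.comp_def] at hxp ⊢
  · have hp : (p : X) ∈ K := hA.isClosed.mem_of_tendsto hxp (Eventually.of_forall hK)
    simp only [hA.cellwiseMap_of_mem g hp, hA.cellwiseMap_of_mem g (hK _)]
    exact (hA.continuousOn g p hp).tendsto.comp
      (tendsto_nhdsWithin_iff.2 ⟨hxp, Eventually.of_forall hK⟩)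
  · have hp : (p : X) ∈ closure (C i) := mem_closure_of_tendsto hxp (Eventually.of_forall hi)
    simp only [hA.cellwiseMap_of_mem_closure g hp, hA.cellwiseMap_of_mem_cell g (hi _)]
    exact (hA.cell_continuousOn g i p hp).tendsto.comp
      (tendsto_nhdsWithin_iff.2 ⟨hxp, Eventually.of_forall fun k => subset_closure (hi k)⟩)
  · choose y hy using fun k => (hA.frontier_nontrivial (u k)).nonempty
    have hyK : ∀ k, y k ∈ K := fun k => hA.frontier_subset _ (hy k)
    have hyp : Tendsto y atTop (𝓝 (p : X)) := tendsto_of_tendsto_dist hxp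
      (hA.null u hu _ _ (fun k => frontier_subset_closure (hy k)) fun k => subset_closure (hux k))
    have hp : (p : X) ∈ K := hA.isClosed.mem_of_tendsto hyp (Eventually.of_forall hyK)
    refine tendsto_of_tendsto_dist (x := fun k => m g (y k)) ?_ (hA.null (fun k => σ g (u k))
      ((hA.index_injective g).tendsto_cofinite.comp hu) _ _
      (fun k => subset_closure (hA.cellwiseMap_mem_cell g (hux k)))
      fun k => hA.action_mem_closure g (hy k))
    rw [hA.cellwiseMap_of_mem g hp]
    exact (hA.continuousOn g p hp).tendsto.comp
      (tendsto_nhdsWithin_iff.2 ⟨hyp, Eventually.of_forall hyK⟩)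

/-- Points in cells are compared with boundary points, to which the collapse on `K` applies. This
needs the image cells to shrink, so the work is to show that they escape. -/
theorem seqCollapse (hA : IsCellwiseAction D K C m σ H) {g : ℕ → G} (hg : Function.Injective g)
    {a b : X} (h : SeqCollapse (fun k => m (g k)) K a b) :
    SeqCollapse (fun k => cellwiseMap C m H (g k)) D a b := by
  intro φ hφ x hxD p hpb hxp
  refine tendsto_of_subseq_tendsto fun ns hns => ?_
  obtain ⟨ψ, hψ, hcase⟩ := hA.exists_subseq fun k => hxD (ns k)
  have hτ := hφ.comp (hns.comp hψ.tendsto_atTop)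
  replace hxp := hxp.comp (hns.comp hψ.tendsto_atTop)
  obtain hK | ⟨i, hi⟩ | ⟨u, hu, hux⟩ := hcase
  · refine ⟨ψ, ?_⟩
    simp only [hA.cellwiseMap_of_mem _ (hK _)]
    exact h _ hτ _ hK p hpb hxp
  · refine ⟨ψ, ?_⟩
    -- For a single cell, freeness on indices makes the images escape; the comparison point must
    -- avoid `b`.
    obtain ⟨y, hy, hyb⟩ := (hA.frontier_nontrivial i).exists_ne b
    have hya := h _ hτ (fun _ => y) (fun _ => hA.frontier_subset i hy) y hyb tendsto_const_nhds
    have hcof : Tendsto (fun k => σ (g k) i) atTop cofinite := by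
      rw [← Nat.cofinite_eq_atTop]
      exact ((hA.index_orbit_injective i).comp hg).tendsto_cofinite
    exact tendsto_of_tendsto_dist hya (hA.null _ (hcof.comp hτ) _ _
      (fun k => subset_closure (hA.cellwiseMap_mem_cell _ (hi k)))
      fun k => hA.action_mem_closure _ hy)
  · obtain ⟨θ, hθ, hcase⟩ := exists_strictMono_const_or_tendsto_cofinite
      (fun k => σ (g (φ (ns (ψ k)))) (u k))
    refine ⟨ψ ∘ θ, ?_⟩
    replace hτ := hτ.comp hθ.tendsto_atTop
    replace hxp := hxp.comp hθ.tendsto_atTop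
    replace hu := hu.comp hθ.tendsto_atTop
    obtain ⟨j, hj⟩ | hc := hcase
    -- If the images stay in one cell `j`, take `z ≠ a` on its boundary. The preimages of `z` lie on
    -- the shrinking cells and tend to `p ≠ b`, so collapse sends them to `a`; yet they are sent to
    -- `z`.
    · exfalso
      obtain ⟨z, hz, hza⟩ := (hA.frontier_nontrivial j).exists_ne a
      have hzK := hA.frontier_subset j hz
      set γ : ℕ → G := fun k => g (φ (ns (ψ (θ k)))) with hγ
      have hidx : ∀ k, σ (γ k)⁻¹ j = u (θ k) := fun k => by rw [← hj k, hA.index_inv]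
      have hwp : Tendsto (fun k => m (γ k)⁻¹ z) atTop (𝓝 p) := by
        refine tendsto_of_tendsto_dist hxp (hA.null _ hu _ _ (fun k => ?_)
          fun k => subset_closure (hux (θ k)))
        have := hA.action_mem_closure (γ k)⁻¹ hz
        rwa [hidx] at this
      have hlim := h _ hτ _ (fun k => hA.mapsTo (γ k)⁻¹ hzK) p hpb hwp
      have hconst : ∀ k, m (γ k) (m (γ k)⁻¹ z) = z := fun k => by
        rw [← hA.mul _ _ _ hzK, inv_mul_cancel, hA.one z hzK]
      have : Tendsto (fun _ : ℕ => z) atTop (𝓝 a) := by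
        refine hlim.congr fun k => hconst k
      exact hza (tendsto_nhds_unique tendsto_const_nhds this)
    · choose y hy using fun k => (hA.frontier_nontrivial (u (θ k))).nonempty
      have hyp : Tendsto y atTop (𝓝 p) := tendsto_of_tendsto_dist hxp
        (hA.null _ hu _ _ (fun k => frontier_subset_closure (hy k))
          fun k => subset_closure (hux (θ k)))
      have hya := h _ hτ y (fun k => hA.frontier_subset _ (hy k)) p hpb hyp
      exact tendsto_of_tendsto_dist hya (hA.null _ hc _ _
        (fun k => subset_closure (hA.cellwiseMap_mem_cell _ (hux (θ k))))
        fun k => hA.action_mem_closure _ (hy k))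

end IsCellwiseAction

end Cellwise

/-! ### Total functions from maps on subsets. -/

section Extension

variable {X : Type*}

open Classical in
/-- Extend a function on a subset by the identity. -/
noncomputable def extendById (s : Set X) (F : s → X) (x : X) : X :=
  if h : x ∈ s then F ⟨x, h⟩ else x

theorem extendById_of_mem {s : Set X} (F : s → X) {x : X} (h : x ∈ s) :
    extendById s F x = F ⟨x, h⟩ :=
  dif_pos h

theorem continuousOn_extendById [TopologicalSpace X] {s : Set X} {F : s → X} (hF : Continuous F) :
    ContinuousOn (extendById s F) s := by
  rw [continuousOn_iff_continuous_domRestrict]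
  convert hF using 1
  ext x
  exact extendById_of_mem F x.2

end Extension

/-! ### Radial extension of sphere maps. -/

section Cone

variable {E : Type*} [NormedAddCommGroup E] [NormedSpace ℝ E] {f g : E → E}

/-- The cone of a self-map of the unit sphere. -/
noncomputable def coneMap (f : E → E) (x : E) : E := ‖x‖ • f (‖x‖⁻¹ • x)

theorem norm_inv_smul_mem_sphere {x : E} (hx : x ≠ 0) :
    ‖x‖⁻¹ • x ∈ Metric.sphere (0 : E) 1 := by
  rw [mem_sphere_zero_iff_norm, norm_smul, norm_inv, norm_norm,
    inv_mul_cancel₀ (norm_ne_zero_iff.2 hx)]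

theorem norm_coneMap (hf : MapsTo f (Metric.sphere 0 1) (Metric.sphere 0 1)) (x : E) :
    ‖coneMap f x‖ = ‖x‖ := by
  rcases eq_or_ne x 0 with rfl | hx
  · simp [coneMap]
  · rw [coneMap, norm_smul, norm_norm,
      mem_sphere_zero_iff_norm.1 (hf (norm_inv_smul_mem_sphere hx)), mul_one]

theorem coneMap_of_mem_sphere {x : E} (hx : x ∈ Metric.sphere (0 : E) 1) :
    coneMap f x = f x := by
  rw [mem_sphere_zero_iff_norm] at hx
  simp [coneMap, hx]

theorem coneMap_congr (h : EqOn f g (Metric.sphere 0 1)) (x : E) : coneMap f x = coneMap g x := by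
  rcases eq_or_ne x 0 with rfl | hx
  · simp [coneMap]
  · rw [coneMap, coneMap, h (norm_inv_smul_mem_sphere hx)]

theorem coneMap_id (x : E) : coneMap id x = x := by
  rcases eq_or_ne x 0 with rfl | hx
  · simp [coneMap]
  · rw [coneMap, id, smul_smul, mul_inv_cancel₀ (norm_ne_zero_iff.2 hx), one_smul]

theorem coneMap_comp (hf : MapsTo f (Metric.sphere 0 1) (Metric.sphere 0 1)) (x : E) :
    coneMap (g ∘ f) x = coneMap g (coneMap f x) := by
  rcases eq_or_ne x 0 with rfl | hx
  · simp [coneMap]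
  · rw [coneMap, coneMap, norm_coneMap hf, coneMap, smul_smul,
      inv_mul_cancel₀ (norm_ne_zero_iff.2 hx), one_smul, Function.comp_apply]

/-- At the origin continuity follows from preservation of the norm. -/
theorem continuous_coneMap (hf : MapsTo f (Metric.sphere 0 1) (Metric.sphere 0 1))
    (hfc : ContinuousOn f (Metric.sphere 0 1)) : Continuous (coneMap f) := by
  rw [continuous_iff_continuousAt]
  intro x
  rcases eq_or_ne x 0 with rfl | hx
  · have h0 : coneMap f 0 = 0 := by simp [coneMap]
    rw [ContinuousAt, h0, tendsto_zero_iff_norm_tendsto_zero]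
    simp only [norm_coneMap hf]
    exact tendsto_norm_zero
  · have h1 : ContinuousOn (fun y : E => ‖y‖⁻¹ • y) {0}ᶜ :=
      (continuous_norm.continuousOn.inv₀ fun y hy => norm_ne_zero_iff.2 hy).smul continuousOn_id
    have h2 : ContinuousOn (coneMap f) {0}ᶜ :=
      continuous_norm.continuousOn.smul (hfc.comp h1 fun y hy => norm_inv_smul_mem_sphere hy)
    exact h2.continuousAt (isOpen_compl_singleton.mem_nhds hx)

end Cone

/-! ### Uniform convergence on compact sets versus convergence along sequences. -/

section Collapse

variable {X : Type*} [MetricSpace X]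

theorem seqCollapse_of_tendstoUniformlyOn {K : Set X} (hK : IsCompact K) {F : ℕ → K → K}
    {f : ℕ → X → X} (hf : ∀ k x, (F k x : X) = f k x) {a b : K}
    (h : ∀ C : Set K, IsCompact C → b ∉ C → TendstoUniformlyOn F (fun _ => a) atTop C) :
    SeqCollapse f K a b := by
  intro φ hφ x hx p hpb hxp
  have hp : p ∈ K := hK.isClosed.mem_of_tendsto hxp (Eventually.of_forall hx)
  have : CompactSpace K := isCompact_iff_compactSpace.1 hK
  have hpos : 0 < dist p b := dist_pos.2 hpb
  -- Half the distance keeps `b` outside the ball, which still contains `x k` eventually.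
  have hC : IsCompact (Metric.closedBall (⟨p, hp⟩ : K) (dist p b / 2)) :=
    Metric.isClosed_closedBall.isCompact
  have hu := h _ hC (by
    rw [Metric.mem_closedBall, not_le, dist_comm b, Subtype.dist_eq]
    exact half_lt_self hpos)
  rw [Metric.tendstoUniformlyOn_iff] at hu
  rw [Metric.tendsto_nhds]
  intro ε hε
  filter_upwards [hφ.eventually (hu ε hε),
    hxp.eventually (Metric.closedBall_mem_nhds p (half_pos hpos))] with k hk hxk
  have := hk ⟨x k, hx k⟩ hxk
  rwa [dist_comm, Subtype.dist_eq, hf] at this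

theorem SeqCollapse.tendstoUniformlyOn {D : Set X} {F : ℕ → D → D} {f : ℕ → X → X}
    (hf : ∀ k x, (F k x : X) = f k x) {a b : D} (h : SeqCollapse f D a b) {C : Set D}
    (hC : IsCompact C) (hb : b ∉ C) : TendstoUniformlyOn F (fun _ => a) atTop C := by
  rw [Metric.tendstoUniformlyOn_iff]
  by_contra! hne
  obtain ⟨ε, hε, hfreq⟩ := hne
  obtain ⟨φ, hφ, hx⟩ := extraction_of_frequently_atTop hfreq
  choose x hxC hxε using hx
  obtain ⟨p, hpC, ψ, hψ, hxp⟩ := hC.tendsto_subseq hxC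
  have hpb : (p : X) ≠ b := fun h => hb (Subtype.ext h ▸ hpC)
  have hlim := h (φ ∘ ψ) (hφ.comp hψ).tendsto_atTop (fun k => (x (ψ k) : X))
    (fun k => (x (ψ k)).2) p hpb ((continuous_subtype_val.tendsto p).comp hxp)
  obtain ⟨k, hk⟩ := (Metric.tendsto_nhds.1 hlim ε hε).exists
  have := hxε (ψ k)
  rw [dist_comm, Subtype.dist_eq, hf] at this
  exact absurd hk (not_lt.2 this)

end Collapse

/-! ### Topology of the cells and uniqueness of a cell with given boundary. -/

section Cells

variable {n : ℕ} {G : Type*} [Group G] {K : Set (EuclideanSpace ℝ (Fin n))}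
  {𝒰 : Set (Set (EuclideanSpace ℝ (Fin n)))}

namespace IsCellDecomposition

theorem isOpen_disk_diff (h : IsCellDecomposition K 𝒰) : IsOpen (Disk n \ K) := by
  have : Disk n \ K = IntDisk n \ K := by
    ext x
    refine ⟨fun hx => ⟨?_, hx.2⟩, fun hx => ⟨Metric.ball_subset_closedBall hx.1, hx.2⟩⟩
    exact lt_of_le_of_ne hx.1 fun h1 => hx.2 (h.sphere_subset h1)
  rw [this]
  exact Metric.isOpen_ball.sdiff h.isClosed

theorem isOpen_cell (h : IsCellDecomposition K 𝒰) {U} (hU : U ∈ 𝒰) : IsOpen U := by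
  rw [h.cells_eq] at hU
  obtain ⟨x, -, rfl⟩ := hU
  exact h.isOpen_disk_diff.connectedComponentIn

theorem cell_subset (h : IsCellDecomposition K 𝒰) {U} (hU : U ∈ 𝒰) : U ⊆ Disk n \ K := by
  rw [h.cells_eq] at hU
  obtain ⟨x, -, rfl⟩ := hU
  exact connectedComponentIn_subset _ _

theorem cell_eq (h : IsCellDecomposition K 𝒰) {U V} (hU : U ∈ 𝒰) (hV : V ∈ 𝒰) {x} (hxU : x ∈ U)
    (hxV : x ∈ V) : U = V := by
  rw [h.cells_eq] at hU hV
  obtain ⟨y, -, rfl⟩ := hU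
  obtain ⟨z, -, rfl⟩ := hV
  rw [connectedComponentIn_eq hxU, connectedComponentIn_eq hxV]

theorem exists_cell (h : IsCellDecomposition K 𝒰) {x} (hx : x ∈ Disk n) (hK : x ∉ K) :
    ∃ U ∈ 𝒰, x ∈ U := by
  rw [h.cells_eq]
  exact ⟨_, ⟨x, ⟨hx, hK⟩, rfl⟩, mem_connectedComponentIn ⟨hx, hK⟩⟩

theorem nonempty_cell (h : IsCellDecomposition K 𝒰) {U} (hU : U ∈ 𝒰) : U.Nonempty := by
  rw [h.cells_eq] at hU
  obtain ⟨x, hx, rfl⟩ := hU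
  exact ⟨x, mem_connectedComponentIn hx⟩

theorem closure_subset_disk (h : IsCellDecomposition K 𝒰) {U} (hU : U ∈ 𝒰) :
    closure U ⊆ Disk n :=
  closure_minimal (fun _ hx => (h.cell_subset hU hx).1) Metric.isClosed_closedBall

theorem frontier_subset (h : IsCellDecomposition K 𝒰) {U} (hU : U ∈ 𝒰) : frontier U ⊆ K := by
  intro x hx
  by_contra hK
  obtain ⟨V, hV, hxV⟩ := h.exists_cell (h.closure_subset_disk hU (frontier_subset_closure hx)) hK
  obtain ⟨y, hyV, hyU⟩ := mem_closure_iff.1 (frontier_subset_closure hx) V (h.isOpen_cell hV) hxV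
  rw [h.cell_eq hV hU hyV hyU] at hxV
  rw [(h.isOpen_cell hU).frontier_eq] at hx
  exact hx.2 hxV

theorem frontier_nontrivial (hn : 3 ≤ n) (h : IsCellDecomposition K 𝒰) {U} (hU : U ∈ 𝒰) :
    (frontier U).Nontrivial := by
  obtain ⟨e⟩ := h.frontier_homeo U hU
  have : Nonempty (Fin n) := ⟨⟨0, by omega⟩⟩
  obtain ⟨x, hx⟩ := NormedSpace.sphere_nonempty (E := EuclideanSpace ℝ (Fin n)) (x := 0) (r := 1)
    |>.2 zero_le_one
  have hx1 : ‖x‖ = 1 := by simpa using hx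
  have hx' : -x ∈ Sph n := by simpa using hx1
  refine ⟨e.symm ⟨x, hx⟩, (e.symm _).2, e.symm ⟨-x, hx'⟩, (e.symm _).2, fun heq => ?_⟩
  have h1 := congrArg Subtype.val (e.symm.injective (Subtype.ext heq))
  have h2 : x = 0 := by
    have h3 : (2 : ℝ) • x = 0 := by rw [two_smul]; exact add_eq_zero_iff_eq_neg.2 h1
    simpa using h3
  rw [h2, norm_zero] at hx1
  exact zero_ne_one hx1

/-- Infinitely many large cells would, by compactness of the disk, contain two convergent sequences
with limits at least `ε` apart, against the one-point limit set. -/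
theorem finite_setOf_le_dist (h : IsCellDecomposition K 𝒰) {ε : ℝ} (hε : 0 < ε) :
    {U : 𝒰 | ∃ x ∈ (U : Set (EuclideanSpace ℝ (Fin n))),
      ∃ y ∈ (U : Set (EuclideanSpace ℝ (Fin n))), ε ≤ dist x y}.Finite := by
  by_contra hinf
  let e := Set.Infinite.natEmbedding _ hinf
  choose x hx y hy hxy using fun k => (e k).2
  have hxD : ∀ k, x k ∈ Disk n := fun k => (h.cell_subset (e k).1.2 (hx k)).1
  have hyD : ∀ k, y k ∈ Disk n := fun k => (h.cell_subset (e k).1.2 (hy k)).1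
  obtain ⟨p, -, φ, hφ, hxp⟩ := (isCompact_closedBall _ _).tendsto_subseq hxD
  obtain ⟨q, -, ψ, hψ, hyq⟩ := (isCompact_closedBall _ _).tendsto_subseq fun k => hyD (φ k)
  replace hxp := hxp.comp hψ.tendsto_atTop
  obtain ⟨θ, hθ, r, hr⟩ := h.exists_lim_eq_singleton (fun k => (e (φ (ψ k))).1)
    (Subtype.val_injective.comp (Subtype.val_injective.comp
      (e.injective.comp (hφ.comp hψ).injective))) (fun k => (e _).1.2)
  have hp : p ∈ ({r} : Set _) := hr ▸ ⟨_, fun k => hx _, hxp.comp hθ.tendsto_atTop⟩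
  have hq : q ∈ ({r} : Set _) := hr ▸ ⟨_, fun k => hy _, hyq.comp hθ.tendsto_atTop⟩
  have hle : ε ≤ dist p q := ge_of_tendsto' (hxp.dist hyq) fun k => hxy _
  rw [mem_singleton_iff.1 hp, mem_singleton_iff.1 hq, dist_self] at hle
  exact absurd hε (not_lt.2 hle)

theorem tendsto_dist_zero (h : IsCellDecomposition K 𝒰) {u : ℕ → 𝒰}
    (hu : Tendsto u atTop cofinite) {x y : ℕ → EuclideanSpace ℝ (Fin n)}
    (hx : ∀ k, x k ∈ closure (u k : Set (EuclideanSpace ℝ (Fin n))))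
    (hy : ∀ k, y k ∈ closure (u k : Set (EuclideanSpace ℝ (Fin n)))) :
    Tendsto (fun k => dist (x k) (y k)) atTop (𝓝 0) := by
  rw [Metric.tendsto_nhds]
  intro ε hε
  have h3 : 0 < ε / 3 := by positivity
  filter_upwards [hu.eventually (h.finite_setOf_le_dist h3).eventually_cofinite_notMem] with k hk
  obtain ⟨x', hx', hxx'⟩ := Metric.mem_closure_iff.1 (hx k) _ h3
  obtain ⟨y', hy', hyy'⟩ := Metric.mem_closure_iff.1 (hy k) _ h3
  have h1 : dist x' y' < ε / 3 := by
    by_contra hlt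
    exact hk ⟨x', hx', y', hy', not_lt.1 hlt⟩
  have := dist_triangle4_right (x k) (y k) x' y'
  rw [Real.dist_eq, sub_zero, abs_of_nonneg dist_nonneg]
  linarith

end IsCellDecomposition

theorem act_mul_apply (μ : G →* (K ≃ₜ K)ᵐᵒᵖ) (g h : G) (x : K) :
    act μ (g * h) x = act μ h (act μ g x) := by
  simp [act]

theorem act_one_apply (μ : G →* (K ≃ₜ K)ᵐᵒᵖ) (x : K) : act μ 1 x = x := by
  simp [act]

/-- Two cells with the same boundary are equal: otherwise the reflection of the closure of one of
them to the closure of the other would be a map that cannot exist by Brouwer's theorem. -/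
theorem IsMarking.cell_eq_of_frontier_eq {μ : G →* (K ≃ₜ K)ᵐᵒᵖ}
    (h : IsCellDecomposition K 𝒰)
    {Φ : ∀ U : 𝒰, Disk n ≃ₜ closure (U : Set (EuclideanSpace ℝ (Fin n)))}
    (hΦ : IsMarking μ 𝒰 Φ) {U V : 𝒰}
    (hUV : frontier (U : Set (EuclideanSpace ℝ (Fin n))) = frontier V) : U = V := by
  by_contra hne
  obtain ⟨a, ha⟩ := h.nonempty_cell U.2
  set A : Set (EuclideanSpace ℝ (Fin n)) := closure (U : Set (EuclideanSpace ℝ (Fin n)))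
  set T := extendById A fun x => (Φ V ((Φ U).symm x) : EuclideanSpace ℝ (Fin n)) with hT
  have hTA : ContinuousOn T A := continuousOn_extendById (by fun_prop)
  have hTid : ∀ x ∉ (U : Set (EuclideanSpace ℝ (Fin n))), T x = x := by
    intro x hx
    by_cases hxA : x ∈ A
    · have hxf : x ∈ frontier (U : Set (EuclideanSpace ℝ (Fin n))) :=
        (IsCellwiseAction.mem_or_mem_frontier hxA).resolve_left hx
      rw [hT, extendById_of_mem _ hxA]
      set s := (Φ U).symm ⟨x, hxA⟩ with hs
      have hΦs : (Φ U s : EuclideanSpace ℝ (Fin n)) = x := by rw [hs, (Φ U).apply_symm_apply]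
      have hsS : (s : EuclideanSpace ℝ (Fin n)) ∈ Sph n := by
        rw [← hΦ.mem_frontier_iff U s, hΦs]
        exact hxf
      -- Equivariance for the identity element forces `Φ U` and `Φ V` to agree on the sphere once
      -- the boundaries coincide.
      have := hΦ.equivariant 1 U V (by
        have h1 : (act μ (1 : G) : K → K) = id := funext fun x => act_one_apply μ x
        rw [h1, image_id, hUV]) ⟨s, h.sphere_subset hsS⟩ ⟨x, h.frontier_subset U.2 hxf⟩ s s hsS rfl
        (by rw [act_one_apply]) hΦs.symm
      rw [act_one_apply] at this
      exact this.symm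
    · exact dif_neg hxA
  have hTc : Continuous T := by
    rw [← continuousOn_univ]
    have : (univ : Set (EuclideanSpace ℝ (Fin n))) = A ∪ (U : Set (EuclideanSpace ℝ (Fin n)))ᶜ := by
      refine (eq_univ_of_forall fun x => ?_).symm
      by_cases hx : x ∈ (U : Set (EuclideanSpace ℝ (Fin n)))
      · exact Or.inl (subset_closure hx)
      · exact Or.inr hx
    rw [this]
    exact hTA.union_of_isClosed (continuousOn_id.congr hTid) isClosed_closure
      (h.isOpen_cell U.2).isClosed_compl
  -- Points of `U` go to `closure V`, which is disjoint from the open set `U` containing `a`; all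
  -- others are fixed outside `U`.
  have hTa : ∀ x, T x ≠ a := by
    intro x hx
    by_cases hxU : x ∈ (U : Set (EuclideanSpace ℝ (Fin n)))
    · rw [hT, extendById_of_mem _ (subset_closure hxU)] at hx
      have haV : a ∈ closure (V : Set (EuclideanSpace ℝ (Fin n))) := hx ▸ (Φ V _).2
      obtain ⟨y, hyU, hyV⟩ := mem_closure_iff.1 haV U (h.isOpen_cell U.2) ha
      exact hne (Subtype.ext (h.cell_eq U.2 V.2 hyU hyV))
    · rw [hTid x hxU] at hx
      exact hxU (hx ▸ ha)
  -- Translation moves `a` to 0; radius 2 suffices since `U` and `a` lie in the unit ball.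
  obtain ⟨x, hx⟩ := exists_eq_zero_of_eq_self_of_lt_norm (F := fun y => T (y + a) - a) (R := 2)
    (by fun_prop) (fun y hy => by
      rw [hTid, add_sub_cancel_right]
      intro hyU
      have h1 : ‖y + a‖ ≤ 1 := by simpa using (h.cell_subset U.2 hyU).1
      have h2 : ‖a‖ ≤ 1 := by simpa using (h.cell_subset U.2 ha).1
      have h3 : ‖y‖ ≤ ‖y + a‖ + ‖a‖ := by simpa using norm_sub_le (y + a) a
      linarith)
  exact hTa _ (sub_eq_zero.1 hx)

end Cells

/-! ### The extended action on the disk. -/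

/-- The action on `D` by the maps `cellwiseMap`. -/
noncomputable def IsCellwiseAction.toMonoidHom {X G ι : Type*} [MetricSpace X] [Group G]
    {D K : Set X} {C : ι → Set X} {m : G → X → X} {σ : G → ι → ι} {H : G → ι → X → X}
    (hA : IsCellwiseAction D K C m σ H) : G →* (D ≃ₜ D)ᵐᵒᵖ where
  toFun g := MulOpposite.op
    { toFun := fun x => ⟨cellwiseMap C m H g x, hA.cellwiseMap_mapsTo g x.2⟩
      invFun := fun x => ⟨cellwiseMap C m H g⁻¹ x, hA.cellwiseMap_mapsTo g⁻¹ x.2⟩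
      left_inv := fun x => Subtype.ext <|
        (hA.cellwiseMap_mul g g⁻¹ x.2).symm.trans (by rw [mul_inv_cancel, hA.cellwiseMap_one x.2])
      right_inv := fun x => Subtype.ext <|
        (hA.cellwiseMap_mul g⁻¹ g x.2).symm.trans (by rw [inv_mul_cancel, hA.cellwiseMap_one x.2])
      continuous_toFun := (hA.continuous_cellwiseMap g).subtype_mk _
      continuous_invFun := (hA.continuous_cellwiseMap g⁻¹).subtype_mk _ }
  map_one' := MulOpposite.unop_injective <| Homeomorph.ext fun x => Subtype.ext <|
    hA.cellwiseMap_one x.2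
  map_mul' g h := MulOpposite.unop_injective <| Homeomorph.ext fun x => Subtype.ext <|
    hA.cellwiseMap_mul g h x.2

variable {n : ℕ} {G : Type*} [Group G] {K : Set (EuclideanSpace ℝ (Fin n))}
  {𝒰 : Set (Set (EuclideanSpace ℝ (Fin n)))} {μ : G →* (K ≃ₜ K)ᵐᵒᵖ}

/-- The homeomorphism `μ(g)` of `K`, extended by the identity. -/
noncomputable def totalAct (μ : G →* (K ≃ₜ K)ᵐᵒᵖ) (g : G) :
    EuclideanSpace ℝ (Fin n) → EuclideanSpace ℝ (Fin n) :=
  extendById K fun x => act μ g x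

theorem totalAct_coe (μ : G →* (K ≃ₜ K)ᵐᵒᵖ) (g : G) (x : K) : totalAct μ g x = act μ g x :=
  extendById_of_mem _ x.2

theorem IsGAction.totalAct_mapsTo_sphere (hK : Sph n ⊆ K) (h : IsGAction μ 𝒰) (g : G) :
    MapsTo (totalAct μ g) (Sph n) (Sph n) := by
  intro x hx
  have : act μ g ⟨x, hK hx⟩ ∈ within K (Sph n) := by
    rw [← h.map_sphere g]
    exact mem_image_of_mem _ hx
  rw [totalAct, extendById_of_mem _ (hK hx)]
  exact this

/-- The cone extensions of the action on the sphere, transported to the cells by the marking,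
extend the action from `K` to `D^n`. -/
theorem IsGComplex.exists_isCellwiseAction (hn : 3 ≤ n) (hcomplex : IsGComplex μ 𝒰)
    (hstab : ∀ U ∈ 𝒰, stab μ U = {1}) :
    ∃ σ H, IsCellwiseAction (Disk n) K (fun U : 𝒰 => (U : Set (EuclideanSpace ℝ (Fin n))))
      (totalAct μ) σ H := by
  obtain ⟨h, hact, Φ, hΦ⟩ := hcomplex
  have hmark : ∀ U V : 𝒰, within K (frontier (U : Set (EuclideanSpace ℝ (Fin n)))) =
      within K (frontier (V : Set (EuclideanSpace ℝ (Fin n)))) → U = V := by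
    intro U V hUV
    refine hΦ.cell_eq_of_frontier_eq h (Subset.antisymm (fun x hx => ?_) fun x hx => ?_)
    · have : (⟨x, h.frontier_subset U.2 hx⟩ : K) ∈
        within K (frontier (V : Set (EuclideanSpace ℝ (Fin n)))) := hUV ▸ hx
      exact this
    · have : (⟨x, h.frontier_subset V.2 hx⟩ : K) ∈
        within K (frontier (U : Set (EuclideanSpace ℝ (Fin n)))) := hUV ▸ hx
      exact this
  have hex : ∀ (g : G) (U : 𝒰), ∃ V : 𝒰,
      act μ g '' within K (frontier (U : Set (EuclideanSpace ℝ (Fin n)))) =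
        within K (frontier (V : Set (EuclideanSpace ℝ (Fin n)))) := fun g U => by
    obtain ⟨V, hV, hUV⟩ := hact.map_frontier g U U.2
    exact ⟨⟨V, hV⟩, hUV⟩
  choose σ hσ using hex
  have hone : ∀ U, σ 1 U = U := fun U => hmark _ _ <| by
    have h1 : (act μ (1 : G) : K → K) = id := funext fun x => act_one_apply μ x
    rw [← hσ, h1, image_id]
  have hmul : ∀ g k U, σ (g * k) U = σ k (σ g U) := fun g k U => hmark _ _ <| by
    have h1 : (act μ (g * k) : K → K) = act μ k ∘ act μ g := funext fun x => act_mul_apply μ g k x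
    rw [← hσ, ← hσ, ← hσ, h1, image_comp]
  set P : 𝒰 → EuclideanSpace ℝ (Fin n) → EuclideanSpace ℝ (Fin n) :=
    fun U => extendById (Disk n) fun x => Φ U x with hP
  set Q : 𝒰 → EuclideanSpace ℝ (Fin n) → EuclideanSpace ℝ (Fin n) :=
    fun U => extendById (closure (U : Set (EuclideanSpace ℝ (Fin n)))) fun x => (Φ U).symm x with hQ
  have hPc : ∀ U, ContinuousOn (P U) (Disk n) := fun U => continuousOn_extendById (by fun_prop)
  have hQc : ∀ U : 𝒰, ContinuousOn (Q U) (closure (U : Set (EuclideanSpace ℝ (Fin n)))) :=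
    fun U => continuousOn_extendById (by fun_prop)
  have hPm : ∀ U : 𝒰, ∀ x ∈ Disk n, P U x ∈ closure (U : Set (EuclideanSpace ℝ (Fin n))) := by
    intro U x hx
    simp only [hP, extendById_of_mem _ hx]
    exact (Φ U _).2
  have hQm : ∀ U : 𝒰, ∀ x ∈ closure (U : Set (EuclideanSpace ℝ (Fin n))), Q U x ∈ Disk n := by
    intro U x hx
    simp only [hQ, extendById_of_mem _ hx]
    exact ((Φ U).symm _).2
  have hPQ : ∀ U : 𝒰, ∀ x ∈ closure (U : Set (EuclideanSpace ℝ (Fin n))), P U (Q U x) = x := by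
    intro U x hx
    simp only [hP, extendById_of_mem _ (hQm U x hx)]
    simp only [hQ, extendById_of_mem _ hx, Subtype.coe_eta, Homeomorph.apply_symm_apply]
  have hQP : ∀ U : 𝒰, ∀ x ∈ Disk n, Q U (P U x) = x := by
    intro U x hx
    simp only [hQ, extendById_of_mem _ (hPm U x hx)]
    simp only [hP, extendById_of_mem _ hx, Subtype.coe_eta, Homeomorph.symm_apply_apply]
  have hPf : ∀ U : 𝒰, ∀ x ∈ Disk n,
      P U x ∈ frontier (U : Set (EuclideanSpace ℝ (Fin n))) ↔ x ∈ Sph n := by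
    intro U x hx
    simp only [hP, extendById_of_mem _ hx]
    exact hΦ.mem_frontier_iff U ⟨x, hx⟩
  have hS := fun g => hact.totalAct_mapsTo_sphere h.sphere_subset g
  have hmc : ∀ g, ContinuousOn (totalAct μ g) K := fun g =>
    continuousOn_extendById (continuous_subtype_val.comp (act μ g).continuous)
  have hmmul : ∀ g k, ∀ x ∈ K, totalAct μ (g * k) x = totalAct μ k (totalAct μ g x) := by
    intro g k x hx
    lift x to K using hx
    simp only [totalAct_coe, act_mul_apply]
  have hmone : ∀ x ∈ K, totalAct μ 1 x = x := by
    intro x hx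
    lift x to K using hx
    rw [totalAct_coe, act_one_apply]
  have hcD : ∀ g, ∀ x ∈ Disk n, coneMap (totalAct μ g) x ∈ Disk n := by
    intro g x hx
    rw [mem_closedBall_zero_iff] at hx ⊢
    rwa [norm_coneMap (hS g)]
  refine ⟨σ, fun g U x => P (σ g U) (coneMap (totalAct μ g) (Q U x)),
    { isClosed := h.isClosed
      subset := h.subset_disk
      cell_subset := fun U x hx => (h.cell_subset U.2 hx).1
      notMem := fun U x hx => (h.cell_subset U.2 hx).2
      index_eq := fun U V x hU hV => Subtype.ext (h.cell_eq U.2 V.2 hU hV)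
      cover := fun x hx hK => by
        obtain ⟨U, hU, hxU⟩ := h.exists_cell hx hK
        exact ⟨⟨U, hU⟩, hxU⟩
      frontier_subset := fun U => h.frontier_subset U.2
      frontier_nontrivial := fun U => h.frontier_nontrivial hn U.2
      null := fun u hu x y hx hy => h.tendsto_dist_zero hu hx hy
      continuousOn := hmc
      mapsTo := fun g x hx => by
        lift x to K using hx
        rw [totalAct_coe]
        exact (act μ g x).2
      mul := hmmul
      one := hmone
      index_mul := hmul
      index_one := hone
      free := fun g U hU => by
        have h1 : g ∈ stab μ (U : Set (EuclideanSpace ℝ (Fin n))) := by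
          have := hσ g U
          rwa [hU] at this
        rw [hstab U U.2] at h1
        exact h1
      cell_continuousOn := fun g U => ?_
      cell_mapsTo := fun g U x hx => ?_
      cell_eqOn := fun g U x hx => ?_
      cell_mul := fun g k U x hx => ?_
      cell_one := fun U x hx => ?_ }⟩
  · have hc := continuous_coneMap (hS g) ((hmc g).mono h.sphere_subset)
    exact (hPc _).comp (hc.comp_continuousOn (hQc U)) fun x hx => hcD g _ (hQm U x hx)
  · have hxc := subset_closure hx
    have hD := hcD g _ (hQm U x hxc)
    -- Cones preserve the norm, so an image on the frontier would come from the sphere, hence from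
    -- `∂U`.
    refine (IsCellwiseAction.mem_or_mem_frontier (hPm _ _ hD)).resolve_right fun hf => ?_
    rw [hPf _ _ hD, mem_sphere_zero_iff_norm, norm_coneMap (hS g), ← mem_sphere_zero_iff_norm,
      ← hPf U _ (hQm U x hxc), hPQ U x hxc] at hf
    exact (h.cell_subset U.2 hx).2 (h.frontier_subset U.2 hf)
  · have hxc := frontier_subset_closure hx
    have hQS : Q U x ∈ Sph n := by
      rw [← hPf U _ (hQm U x hxc), hPQ U x hxc]
      exact hx
    have hgS := hS g hQS
    simp only [coneMap_of_mem_sphere hQS]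
    have h1 := hΦ.equivariant g U (σ g U) (hσ g U) ⟨Q U x, h.sphere_subset hQS⟩
      ⟨x, h.frontier_subset U.2 hx⟩ ⟨Q U x, hQm U x hxc⟩
      ⟨totalAct μ g (Q U x), Metric.sphere_subset_closedBall hgS⟩ hQS rfl
      (totalAct_coe μ g ⟨Q U x, h.sphere_subset hQS⟩) (by
        have := hPQ U x hxc
        simp only [hP, extendById_of_mem _ (hQm U x hxc)] at this
        exact this.symm)
    rw [totalAct_coe μ g ⟨x, h.frontier_subset U.2 hx⟩, h1]
    exact extendById_of_mem _ _
  · have hD := hQm U x (subset_closure hx)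
    -- The marking of the intermediate cell cancels, leaving functoriality of cones.
    rw [hQP _ _ (hcD g _ hD), ← coneMap_comp (hS g), hmul,
      coneMap_congr fun y hy => hmmul g k y (h.sphere_subset hy)]
    rfl
  · rw [hone, coneMap_congr (g := id) fun y hy => hmone y (h.sphere_subset hy), coneMap_id,
      hPQ U x (subset_closure hx)]

end GComplexes

theorem proposition3 {n : ℕ} (hn : 3 ≤ n) {G : Type*} [Group G]
    (K : Set (EuclideanSpace ℝ (Fin n))) (𝒰 : Set (Set (EuclideanSpace ℝ (Fin n))))
    (μ : G →* (K ≃ₜ K)ᵐᵒᵖ)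
    (hcomplex : GComplexes.IsGComplex μ 𝒰)
    (hfree : GComplexes.IsFree μ)
    (hconv : GComplexes.IsConvergence μ)
    (hstab : ∀ U ∈ 𝒰, GComplexes.stab μ U = {1}) :
    ∃ μ₀ : G →* (GComplexes.Disk n ≃ₜ GComplexes.Disk n)ᵐᵒᵖ,
      GComplexes.IsGComplex μ₀ ∅ ∧ GComplexes.IsFree μ₀ ∧ GComplexes.IsConvergence μ₀ ∧
        GComplexes.IsRefinement μ₀ μ := by
  open GComplexes in
  obtain ⟨σ, H, hA⟩ := hcomplex.exists_isCellwiseAction hn hstab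
  obtain ⟨hcell, hact, -⟩ := hcomplex
  have hval : ∀ g (x : Disk n), (act hA.toMonoidHom g x : EuclideanSpace ℝ (Fin n)) =
      cellwiseMap _ (totalAct μ) H g x := fun g x => rfl
  have hext : ∀ g (x : Disk n) (y : K), (x : EuclideanSpace ℝ (Fin n)) = y →
      (act hA.toMonoidHom g x : EuclideanSpace ℝ (Fin n)) = act μ g y := by
    intro g x y hxy
    rw [hval, hxy, hA.cellwiseMap_of_mem g y.2, totalAct_coe]
  have hsph : ∀ g (x : Disk n), (x : EuclideanSpace ℝ (Fin n)) ∈ Sph n →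
      (act hA.toMonoidHom g x : EuclideanSpace ℝ (Fin n)) ∈ Sph n := by
    intro g x hx
    rw [hval, hA.cellwiseMap_of_mem g (hcell.sphere_subset hx)]
    exact hact.totalAct_mapsTo_sphere hcell.sphere_subset g hx
  have hfaith : Function.Injective hA.toMonoidHom := by
    intro g k hgk
    refine hact.faithful (MulOpposite.unop_injective (Homeomorph.ext fun y => Subtype.ext ?_))
    have h1 := hext g ⟨y, hcell.subset_disk y.2⟩ y rfl
    have h2 := hext k ⟨y, hcell.subset_disk y.2⟩ y rfl
    rw [act, hgk] at h1
    exact h1.symm.trans h2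
  refine ⟨hA.toMonoidHom, ⟨?_, ?_, ?_⟩, ?_, ?_, hcell.subset_disk, hext⟩
  · refine ⟨subset_rfl, Metric.isClosed_closedBall, ?_, Metric.sphere_subset_closedBall, ?_, ?_,
      ?_⟩
    · simp [components]
    · simp
    · simp
    · intro U _ hU
      exact absurd (hU 0) (Set.notMem_empty _)
  · refine ⟨hfaith, fun g => Set.Subset.antisymm ?_ ?_, fun g U hU => absurd hU (Set.notMem_empty _),
      fun g => ?_⟩
    · rintro _ ⟨x, hx, rfl⟩
      exact hsph g x hx
    · intro x hx
      refine ⟨act hA.toMonoidHom g⁻¹ x, hsph _ x hx, ?_⟩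
      rw [← act_mul_apply, inv_mul_cancel, act_one_apply]
    · obtain ⟨f, hf, hfg⟩ := hact.orientation g
      refine ⟨f, hf, fun x s hxs => ?_⟩
      rw [hext g x ⟨s, hcell.sphere_subset s.2⟩ hxs]
      exact hfg _ s rfl
  · exact ⟨fun U => absurd U.2 (Set.notMem_empty _), fun U => absurd U.2 (Set.notMem_empty _),
      fun U => absurd U.2 (Set.notMem_empty _), fun _ U => absurd U.2 (Set.notMem_empty _)⟩
  · intro g hg x hx hfix
    have hfix' := congrArg Subtype.val hfix
    by_cases hK : (x : EuclideanSpace ℝ (Fin n)) ∈ K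
    · refine hfree g hg ⟨x, hK⟩ hx (Subtype.ext ?_)
      rw [← hext g x ⟨x, hK⟩ rfl, hfix']
    · exact hg (hA.eq_one_of_cellwiseMap_eq x.2 hK hfix')
  · intro h hinj hmem
    choose g hg using hmem
    have hg' : ∀ k, act hA.toMonoidHom (g k) = h k := fun k => congrArg MulOpposite.unop (hg k)
    have hginj : Function.Injective g := fun i j hij => hinj (by rw [← hg', ← hg', hij])
    -- Faithfulness on `K` keeps the restricted sequence injective; the same `a` and `b` then serve
    -- on the disk.
    obtain ⟨φ, hφ, a, b, hab⟩ := hconv (fun k => act μ (g k))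
      (fun i j hij => hginj (hact.faithful (MulOpposite.unop_injective hij)))
      (fun k => ⟨g k, rfl⟩)
    have hK : IsCompact K := (isCompact_closedBall _ _).of_isClosed_subset hcell.isClosed
      hcell.subset_disk
    have hcol := seqCollapse_of_tendstoUniformlyOn hK (f := fun k => totalAct μ (g (φ k)))
      (fun k x => (totalAct_coe μ _ x).symm) hab
    have hcol' := hA.seqCollapse (hginj.comp hφ.injective) hcol
    refine ⟨φ, hφ, ⟨a, hcell.subset_disk a.2⟩, ⟨b, hcell.subset_disk b.2⟩, fun C hC hb => ?_⟩
    exact SeqCollapse.tendstoUniformlyOn (D := Disk n) (F := fun k x => h (φ k) x)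
      (f := fun k => cellwiseMap _ (totalAct μ) H (g (φ k))) (a := ⟨a, hcell.subset_disk a.2⟩)
      (b := ⟨b, hcell.subset_disk b.2⟩) (fun k x => by rw [← hg', hval]) hcol' hC hb
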